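/- Let $\mathcal I$ be the set of finitely supported sequences $\nu=(\nu_1,\nu_2,\dots)$ with entries in $\{0,1,2\}$; the formal monomials $\mathbf e^{\nu}=\mathbf e_1^{\nu_1}\mathbf e_2^{\nu_2}\cdots$, $\nu\in\mathcal I$, form the basis of the infinite ternary Grassmann algebra with generators $\mathbf e_1,\mathbf e_2,\dots$. Let $c=(c_\nu)_{\nu\in\mathcal I}$ be positive numbers with $c_\nu c_\mu\le c_{\nu+\mu}$ whenever $\nu,\mu,\nu+\mu\in\mathcal I$, with $\sum_\nu c_\nu^{-2d}<\infty$ for $d=1,2,3,\dots$, and nondecreasing along the generators, $c_{\mathbf e_1}\le c_{\mathbf e_2}\le\cdots$ (where $c_{\mathbf e_n}$ is the weight at the multi-index of $\mathbf e_n$); for instance $c_\nu=\exp(\sum_k 3^{k-1}\nu_k)$. For $p\in\mathbb Z$ let $\mathcal H_{p}$ be the Hilbert space of the formal series $f=\sum_\nu f_\nu \mathbf e^\nu$, $f_\nu\in\mathbb C$, with $\|f\|_{\mathcal H_p}^2=\sum_\nu|f_\nu|^2c_\nu^{2p}<\infty$, and let $\mathfrak S_{-1}=\bigcup_{p\ge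 0}\mathcal H_{-p}$ with the (locally convex) inductive limit topology. Let $\xi_n$, $n\ge1$, be the normalized Hermite functions, and for $f\in L^2(\mathbb R,dx)$ let $Xf=\sum_n f_n\mathbf e_n$ with $f_n=\int f\,\xi_n\,dx$. With $\widehat f(u)=\int e^{-iux}f(x)\,dx$, let $S_m$ be the operator in $L^2(\mathbb R,dx)$ given by $\widehat{S_mf}(u)=\sqrt{m(u)}\,\widehat f(u)$ on the domain $\{f\in L^2 : \int m(u)|\widehat f(u)|^2\,du<\infty\}$. For $t<0$ read $\mathbf 1_{[0,t]}$ as $-\mathbf 1_{[t,0]}$. Theorem. Let $m:\mathbb R\to[0,\infty)$ be measurable with $m(u)\le K|u|^{-b}$ for $0<|u|\le 1$ and $m(u)\le K|u|^{2N}$ for $|u|>1$, where $K>0$, $b<2$, $N\in\mathbb N_0$, and with $\int_{\mathbb R}\frac{m(u)}{u^2+1}\,du<\infty$. Then all $\mathbf 1_{[0,t]}$, $t\in\mathbb R$, and all $\xi_n$ belong to the domain of $S_m$, and the processes $$t\mapsto XS_m\mathbf 1_{[0,t]}\qquad\text{and}\qquad t\mapsto\sum_n\Big(\int_0^t (S_m\xi_n)(u)\,du\Big)\mathbf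 e_n$$ take values in $\mathfrak S_{-1}$, are differentiable there at every $t\in\mathbb R$, and have continuous derivatives $\mathbb R\to\mathfrak S_{-1}$. Moreover $XS_m\mathbf 1_{[0,t]}=\sum_n\overline{\int_0^t (S_m\xi_n)(u)\,du}\;\mathbf e_n$ for every $t\in\mathbb R$, so that the two processes coincide when $m$ is even. -/

import Mathlib

open MeasureTheory FourierTransform Topology

noncomputable section

namespace TernaryGrassmann

/-! ### Multi-indices, weights and the spaces of generalized ternary supernumbers -/

/-- The index set of the basis `e^ν = e₀^{ν₀} e₁^{ν₁} ⋯` of the infinite ternary Grassmann algebra: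
finitely supported sequences with entries in `{0, 1, 2}`.
The generators are numbered from `0` instead of from `1`. -/
def Idx : Type := {ν : ℕ →₀ ℕ // ∀ k, ν k ≤ 2}

/-- The multi-index of the generator `eₙ`. -/
def genIdx (n : ℕ) : Idx :=
  ⟨Finsupp.single n 1, fun k => by
    rw [Finsupp.single_apply]; split_ifs <;> omega⟩

theorem genIdx_injective : Function.Injective genIdx := by
  intro m n h
  have h' : Finsupp.single m 1 = Finsupp.single n 1 := congrArg Subtype.val h
  exact Finsupp.single_left_injective one_ne_zero h'

/-- The weights `c = (c_ν)`: positive numbers that are super-multiplicative along the product of the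
algebra, with `∑ c_ν^{-2d} < ∞` for `d = 1, 2, 3, …`, and nondecreasing along the generators
(as is the case for `c_ν = exp (∑ₖ φ (3^k ν_k))` with an increasing function `φ`). -/
structure Weight where
  /-- The family of numbers. -/
  toFun : Idx → ℝ
  pos : ∀ ν, 0 < toFun ν
  mul_le : ∀ ν μ γ : Idx, ν.1 + μ.1 = γ.1 → toFun ν * toFun μ ≤ toFun γ
  summable : ∀ d : ℕ, 1 ≤ d → Summable fun ν => (toFun ν ^ (2 * d))⁻¹
  mono : Monotone fun n => toFun (genIdx n)

instance : CoeFun Weight fun _ => Idx → ℝ := ⟨Weight.toFun⟩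

/-- A weighted square-summable family is a square-summable family after rescaling. -/
theorem memlp_iff (c : Weight) (p : ℤ) (f : Idx → ℂ) :
    Memℓp (fun ν => ((c ν ^ p : ℝ) : ℂ) * f ν) 2 ↔
      Summable fun ν => ‖f ν‖ ^ 2 * c ν ^ (2 * p) := by
  rw [memℓp_gen_iff (by norm_num)]
  refine summable_congr fun ν => ?_
  have h := c.pos ν
  rw [norm_mul, Complex.norm_real, Real.norm_of_nonneg (zpow_pos h p).le]
  simp only [ENNReal.toReal_ofNat, Real.rpow_ofNat]
  rw [mul_pow, ← zpow_natCast (c ν ^ p), ← zpow_mul, mul_comm]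
  congr 2
  push_cast
  ring

/-- The formal series `f = ∑ f_ν e^ν` with `∑ |f_ν|² c_ν^{2p} < ∞`, for `p ∈ ℤ`. -/
def weightedSubmodule (c : Weight) (p : ℤ) : Submodule ℂ (Idx → ℂ) where
  carrier := {f | Summable fun ν => ‖f ν‖ ^ 2 * c ν ^ (2 * p)}
  zero_mem' := by simp [summable_zero]
  add_mem' := by
    intro f g hf hg
    simp only [Set.mem_ofPred_eq] at hf hg ⊢
    rw [← memlp_iff] at hf hg ⊢
    convert hf.add hg using 2
    simp [mul_add]
  smul_mem' := by
    intro a f hf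
    simp only [Set.mem_ofPred_eq] at hf ⊢
    rw [← memlp_iff] at hf ⊢
    convert hf.const_smul a using 2
    simp [mul_left_comm]

/-- The Hilbert space `𝓗_p = 𝓗_p(c)`, a type of its own so that it carries its norm topology. -/
def HSpace (c : Weight) (p : ℤ) : Type := weightedSubmodule c p

instance (c : Weight) (p : ℤ) : AddCommGroup (HSpace c p) :=
  inferInstanceAs (AddCommGroup (weightedSubmodule c p))

instance (c : Weight) (p : ℤ) : Module ℂ (HSpace c p) :=
  inferInstanceAs (Module ℂ (weightedSubmodule c p))

/-- The identification `f ↦ (c_ν^p f_ν)` of `𝓗_p` with a subspace of `ℓ²`. -/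
def HSpace.toEll2 (c : Weight) (p : ℤ) : HSpace c p →ₗ[ℂ] lp (fun _ : Idx => ℂ) 2 where
  toFun f := ⟨fun ν => ((c ν ^ p : ℝ) : ℂ) * f.1 ν, (memlp_iff c p f.1).2 f.2⟩
  map_add' f g := by
    ext ν
    exact mul_add _ (f.1 ν) (g.1 ν)
  map_smul' a f := by
    ext ν
    exact mul_left_comm _ a (f.1 ν)

theorem HSpace.toEll2_injective (c : Weight) (p : ℤ) :
    Function.Injective (HSpace.toEll2 c p) := by
  intro f g h
  apply Subtype.ext
  funext ν
  have h1 : ((c ν ^ p : ℝ) : ℂ) * f.1 ν = ((c ν ^ p : ℝ) : ℂ) * g.1 ν :=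
    congrFun (congrArg Subtype.val h) ν
  exact mul_left_cancel₀ (Complex.ofReal_ne_zero.2 (zpow_pos (c.pos ν) p).ne') h1

instance (c : Weight) (p : ℤ) : NormedAddCommGroup (HSpace c p) :=
  NormedAddCommGroup.induced _ _ (HSpace.toEll2 c p) (HSpace.toEll2_injective c p)

instance (c : Weight) (p : ℤ) : NormedSpace ℂ (HSpace c p) :=
  NormedSpace.induced ℂ _ _ (HSpace.toEll2 c p)

/-- The norm of `𝓗_p` is given by `‖f‖² = ∑ |f_ν|² c_ν^{2p}`. -/
theorem HSpace.norm_sq (c : Weight) (p : ℤ) (f : HSpace c p) :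
    ‖f‖ ^ 2 = ∑' ν, ‖f.1 ν‖ ^ 2 * c ν ^ (2 * p) := by
  have h1 : ‖f‖ = ‖HSpace.toEll2 c p f‖ := rfl
  have h2 := lp.norm_rpow_eq_tsum (p := 2) (by norm_num) (HSpace.toEll2 c p f)
  simp only [ENNReal.toReal_ofNat, Real.rpow_ofNat] at h2
  rw [h1, h2]
  refine tsum_congr fun ν => ?_
  have h := c.pos ν
  change ‖((c ν ^ p : ℝ) : ℂ) * f.1 ν‖ ^ 2 = _
  rw [norm_mul, Complex.norm_real, Real.norm_of_nonneg (zpow_pos h p).le, mul_pow,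
    ← zpow_natCast (c ν ^ p), ← zpow_mul, mul_comm]
  congr 2
  push_cast
  ring

/-- The spaces `𝓗_{-p}` increase with `p`. -/
theorem weightedSubmodule_mono (c : Weight) {p q : ℕ} (h : p ≤ q) :
    weightedSubmodule c (-(p : ℤ)) ≤ weightedSubmodule c (-(q : ℤ)) := by
  obtain ⟨d, rfl⟩ := Nat.exists_eq_add_of_le h
  rcases Nat.eq_zero_or_pos d with rfl | hd
  · simp
  intro f hf
  have hs := c.summable d hd
  have h0 : ∀ ν, 0 ≤ (c ν ^ (2 * d))⁻¹ := fun ν => inv_nonneg.2 (pow_pos (c.pos ν) _).le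
  have hf' : Summable fun ν => ‖f ν‖ ^ 2 * c ν ^ (2 * (-(p : ℤ))) := hf
  refine Summable.of_nonneg_of_le (fun ν => ?_) (fun ν => ?_)
    (hf'.mul_right (∑' ν, (c ν ^ (2 * d))⁻¹))
  · exact mul_nonneg (sq_nonneg _) (zpow_pos (c.pos ν) _).le
  · have h1 : c ν ^ (2 * (-((p + d : ℕ) : ℤ))) =
        c ν ^ (2 * (-(p : ℤ))) * (c ν ^ (2 * d))⁻¹ := by
      rw [← zpow_natCast, ← zpow_neg, ← zpow_add₀ (c.pos ν).ne']
      congr 1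
      push_cast
      ring
    rw [h1, ← mul_assoc]
    refine mul_le_mul_of_nonneg_left (hs.le_tsum ν fun μ _ => h0 μ) ?_
    exact mul_nonneg (sq_nonneg _) (zpow_pos (c.pos ν) _).le

/-- The formal series that lie in `⋃_{p ≥ 0} 𝓗_{-p}`. -/
def distSubmodule (c : Weight) : Submodule ℂ (Idx → ℂ) where
  carrier := {f | ∃ p : ℕ, f ∈ weightedSubmodule c (-(p : ℤ))}
  zero_mem' := ⟨0, zero_mem _⟩
  add_mem' := by
    rintro f g ⟨p, hp⟩ ⟨q, hq⟩
    exact ⟨max p q, add_mem (weightedSubmodule_mono c (le_max_left p q) hp)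
      (weightedSubmodule_mono c (le_max_right p q) hq)⟩
  smul_mem' := by
    rintro a f ⟨p, hp⟩
    exact ⟨p, Submodule.smul_mem _ a hp⟩

/-- The space of stochastic distributions `𝔖₋₁ = ⋃_{p ≥ 0} 𝓗_{-p}`, a type of its own so that it
carries its inductive limit topology. -/
def Dist (c : Weight) : Type := distSubmodule c

/-- The coefficients `(f_ν)` of `f = ∑ f_ν e^ν ∈ 𝔖₋₁`. -/
def Dist.coeff {c : Weight} (f : Dist c) : Idx → ℂ := f.1

instance (c : Weight) : AddCommGroup (Dist c) := inferInstanceAs (AddCommGroup (distSubmodule c))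

instance (c : Weight) : Module ℂ (Dist c) := inferInstanceAs (Module ℂ (distSubmodule c))

/-- The inclusion of `𝓗_{-p}` in `𝔖₋₁`. -/
def Dist.incl (c : Weight) (p : ℕ) : HSpace c (-(p : ℤ)) →ₗ[ℂ] Dist c where
  toFun f := ⟨f.1, p, f.2⟩
  map_add' _ _ := rfl
  map_smul' _ _ := rfl

/-- The topology of `𝔖₋₁`: the inductive limit of the Hilbert spaces `𝓗_{-p}` in the category of
locally convex spaces, that is, the finest locally convex vector space topology for which all the
inclusions `𝓗_{-p} → 𝔖₋₁` are continuous. -/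
instance (c : Weight) : TopologicalSpace (Dist c) :=
  sInf {t : TopologicalSpace (Dist c) |
    (∀ p : ℕ, @Continuous _ _ _ t (Dist.incl c p)) ∧
    @IsTopologicalAddGroup (Dist c) t _ ∧
    @ContinuousSMul ℂ (Dist c) _ _ t ∧
    @LocallyConvexSpace ℝ (Dist c) _ _ _ _ t}

instance (c : Weight) : IsTopologicalAddGroup (Dist c) :=
  topologicalAddGroup_sInf fun _ ⟨_, ht, _, _⟩ => ht

instance (c : Weight) : ContinuousSMul ℂ (Dist c) :=
  continuousSMul_sInf fun _ ⟨_, _, ht, _⟩ => ht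

instance (c : Weight) : LocallyConvexSpace ℝ (Dist c) :=
  .sInf fun _ ⟨_, _, _, ht⟩ => ht

instance (c : Weight) : ContinuousSMul ℝ (Dist c) := IsScalarTower.continuousSMul ℂ

/-- The coefficients are continuous on `𝓗_p`. -/
theorem HSpace.continuous_apply (c : Weight) (p : ℤ) (ν : Idx) :
    Continuous fun f : HSpace c p => f.1 ν := by
  have h1 : Continuous (HSpace.toEll2 c p) := continuous_induced_dom
  have h2 : Continuous fun f : HSpace c p => (HSpace.toEll2 c p f : Idx → ℂ) ν :=
    ((_root_.continuous_apply ν).comp lp.uniformContinuous_coe.continuous).comp h1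
  have h3 : (fun f : HSpace c p => f.1 ν) =
      fun f => ((c ν ^ p : ℝ) : ℂ)⁻¹ * (HSpace.toEll2 c p f : Idx → ℂ) ν := by
    funext f
    exact (inv_mul_cancel_left₀ (Complex.ofReal_ne_zero.2 (zpow_pos (c.pos ν) p).ne') _).symm
  rw [h3]
  exact continuous_const.mul h2

/-- The coefficients are continuous on `𝔖₋₁`. -/
theorem Dist.continuous_coeff (c : Weight) : Continuous (Dist.coeff : Dist c → Idx → ℂ) := by
  let L : Dist c →ₗ[ℂ] (Idx → ℂ) := (distSubmodule c).subtype
  rw [continuous_iff_le_induced]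
  refine sInf_le ⟨fun p => ?_, topologicalAddGroup_induced L, continuousSMul_induced L,
    LocallyConvexSpace.induced (L.restrictScalars ℝ)⟩
  rw [continuous_induced_rng]
  exact continuous_pi fun ν => HSpace.continuous_apply c _ ν

/-- Limits, and hence derivatives, in `𝔖₋₁` are unique. -/
instance (c : Weight) : T2Space (Dist c) :=
  T2Space.of_injective_continuous (f := Dist.coeff) Subtype.val_injective
    (Dist.continuous_coeff c)

/-- The function `F : ℝ → 𝔖₋₁` is differentiable everywhere, and its derivative is continuous. -/
def HasContinuousDeriv {c : Weight} (F : ℝ → Dist c) : Prop :=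
  ∃ F' : ℝ → Dist c, (∀ t, HasDerivAt F (F' t) t) ∧ Continuous F'

/-- The formal series `∑ₙ aₙ eₙ`, as the family of its coefficients: the coefficient at the index of
`eₙ` is `aₙ`, all others vanish. -/
def genSeries (a : ℕ → ℂ) : Idx → ℂ := Function.extend genIdx a 0

/-! ### Hermite functions, the map `X` and the Fourier multiplier `S_m` -/

/-- The Hilbert space `L²(ℝ, dx)` of complex valued functions. -/
abbrev L2 : Type := Lp ℂ 2 (volume : Measure ℝ)

/-- The normalized Hermite functions
`ξₙ(x) = π^{-1/4} (n!)^{-1/2} Heₙ(√2 x) e^{-x²/2}`, `n = 0, 1, 2, …`, with the probabilists' Hermite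
polynomials `Heₙ`; equivalently `(2ⁿ n! √π)^{-1/2} Hₙ(x) e^{-x²/2}` with the physicists' ones. -/
def hermiteFun (n : ℕ) (x : ℝ) : ℝ :=
  (√(n.factorial * √Real.pi))⁻¹ *
    Polynomial.aeval (√2 * x) (Polynomial.hermite n) * Real.exp (-x ^ 2 / 2)

theorem integrable_polynomial_mul_exp (P : Polynomial ℝ) :
    Integrable fun x : ℝ => P.eval x * Real.exp (-x ^ 2) := by
  induction P using Polynomial.induction_on' with
  | add p q hp hq =>
    refine (hp.add hq).congr (Filter.Eventually.of_forall fun x => ?_)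
    simp [add_mul]
  | monomial k a =>
    have h := integrable_rpow_mul_exp_neg_mul_sq (b := 1) one_pos (s := k)
      (lt_of_lt_of_le (by norm_num) k.cast_nonneg)
    simpa [mul_assoc] using h.const_mul a

theorem memLp_hermiteFun (n : ℕ) : MemLp (fun x => (hermiteFun n x : ℂ)) 2 volume := by
  refine MemLp.ofReal (f := hermiteFun n) ?_
  have hc : Continuous (hermiteFun n) := by
    unfold hermiteFun
    fun_prop
  rw [memLp_two_iff_integrable_sq hc.aestronglyMeasurable]
  set Q : Polynomial ℝ := ((Polynomial.hermite n).map (Int.castRingHom ℝ)).comp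
    (Polynomial.C √2 * Polynomial.X) with hQ
  have h := (integrable_polynomial_mul_exp (Q ^ 2)).const_mul
    ((√(n.factorial * √Real.pi))⁻¹ ^ 2)
  refine h.congr (Filter.Eventually.of_forall fun x => ?_)
  have e1 : Polynomial.aeval (√2 * x) (Polynomial.hermite n) = Q.eval x := by
    simp [hQ, Polynomial.aeval_def, Polynomial.eval₂_eq_eval_map]
  have e2 : Real.exp (-x ^ 2) = Real.exp (-x ^ 2 / 2) ^ 2 := by
    rw [← Real.exp_nat_mul]
    congr 1
    push_cast
    ring
  simp only [hermiteFun, e1, e2, Polynomial.eval_pow]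
  ring

/-- The Hermite function `ξₙ` as an element of `L²`. -/
def xi (n : ℕ) : L2 := (memLp_hermiteFun n).toLp

/-- The map `X f = ∑ₙ fₙ eₙ`, where `fₙ = ⟨f, ξₙ⟩ = ∫ f(x) ξₙ(x) dx` are the coefficients of `f` in
the orthonormal basis of the Hermite functions. -/
def X (f : L2) : Idx → ℂ := genSeries fun n => inner ℂ (xi n) f

/-- The indicator function of `[0, t]`; for `t < 0` this is read as `-𝟏_[t, 0]`, as in
`∫_0^t = -∫_t^0`. -/
def ind (t : ℝ) : L2 :=
  if 0 ≤ t then indicatorConstLp 2 (s := Set.Icc 0 t) measurableSet_Icc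
      (by rw [Real.volume_Icc]; exact ENNReal.ofReal_ne_top) 1
  else -indicatorConstLp 2 (s := Set.Icc t 0) measurableSet_Icc
      (by rw [Real.volume_Icc]; exact ENNReal.ofReal_ne_top) 1

/-- The Fourier transform `f̂(u) = ∫ e^{-iux} f(x) dx` of `f ∈ L²`. Mathlib's Fourier transform is
`𝓕 f (v) = ∫ e^{-2πivx} f(x) dx`, so that `f̂(u) = 𝓕 f (u / 2π)`. -/
def hat (f : L2) (u : ℝ) : ℂ := (𝓕 f : L2) (u / (2 * Real.pi))

/-- The operator `S_m` in `L²` given by `(S_m f)^(u) = √(m(u)) f̂(u)`, with its maximal domain. In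
Mathlib's normalization this is the multiplication of `𝓕 f` by `v ↦ √(m(2πv))`. -/
def Sm (m : ℝ → ℝ) : L2 →ₗ.[ℂ] L2 where
  domain :=
    { carrier := {f | MemLp (fun v : ℝ => (√(m (2 * Real.pi * v)) : ℂ) * (𝓕 f : L2) v) 2 volume}
      zero_mem' := by
        have h0 : (𝓕 (0 : L2) : L2) = 0 := (Lp.fourierTransformₗᵢ ℝ ℂ).map_zero
        simp only [Set.mem_ofPred_eq, h0]
        refine MemLp.ae_eq (f := 0) ?_ MemLp.zero
        filter_upwards [Lp.coeFn_zero ℂ 2 (volume : Measure ℝ)] with v hv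
        rw [hv, Pi.zero_apply, mul_zero]
      add_mem' := by
        intro f g hf hg
        have h0 : (𝓕 (f + g) : L2) = 𝓕 f + 𝓕 g := (Lp.fourierTransformₗᵢ ℝ ℂ).map_add f g
        simp only [Set.mem_ofPred_eq, h0] at hf hg ⊢
        refine MemLp.ae_eq ?_ (hf.add hg)
        filter_upwards [Lp.coeFn_add (𝓕 f : L2) (𝓕 g)] with v hv
        rw [hv, Pi.add_apply, Pi.add_apply, mul_add]
      smul_mem' := by
        intro a f hf
        have h0 : (𝓕 (a • f) : L2) = a • 𝓕 f := (Lp.fourierTransformₗᵢ ℝ ℂ).map_smul a f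
        simp only [Set.mem_ofPred_eq, h0] at hf ⊢
        refine MemLp.ae_eq ?_ (hf.const_smul a)
        filter_upwards [Lp.coeFn_smul a (𝓕 f : L2)] with v hv
        rw [hv, Pi.smul_apply, Pi.smul_apply, smul_eq_mul, smul_eq_mul, mul_left_comm] }
  toFun :=
    { toFun := fun f => 𝓕⁻ (MemLp.toLp _ f.2 : L2)
      map_add' := by
        intro f g
        have h0 : (𝓕 (f.1 + g.1) : L2) = 𝓕 f.1 + 𝓕 g.1 :=
          (Lp.fourierTransformₗᵢ ℝ ℂ).map_add f.1 g.1
        refine Eq.trans (congrArg _ ?_) ((Lp.fourierTransformₗᵢ ℝ ℂ).symm.map_add _ _)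
        rw [← MemLp.toLp_add, MemLp.toLp_eq_toLp_iff]
        filter_upwards [Lp.coeFn_add (𝓕 f.1 : L2) (𝓕 g.1)] with v hv
        rw [Submodule.coe_add, h0, hv, Pi.add_apply, Pi.add_apply, mul_add]
      map_smul' := by
        intro a f
        have h0 : (𝓕 (a • f.1) : L2) = a • 𝓕 f.1 :=
          (Lp.fourierTransformₗᵢ ℝ ℂ).map_smul a f.1
        refine Eq.trans (congrArg _ ?_) ((Lp.fourierTransformₗᵢ ℝ ℂ).symm.map_smul _ _)
        rw [← MemLp.toLp_const_smul, MemLp.toLp_eq_toLp_iff]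
        filter_upwards [Lp.coeFn_smul a (𝓕 f.1 : L2)] with v hv
        rw [Submodule.coe_smul, h0, hv, Pi.smul_apply, Pi.smul_apply, smul_eq_mul, smul_eq_mul,
          mul_left_comm]
        rfl }

/-- The defining property of `S_m`. -/
theorem hat_Sm (m : ℝ → ℝ) (f : (Sm m).domain) :
    ∀ᵐ u : ℝ, hat (Sm m f) u = (√(m u) : ℂ) * hat f u := by
  have hpi : (2 * Real.pi)⁻¹ ≠ 0 := inv_ne_zero (by positivity)
  have h1 : (𝓕 (Sm m f) : L2) = MemLp.toLp _ f.2 :=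
    (Lp.fourierTransformₗᵢ ℝ ℂ).apply_symm_apply _
  have h2 := MemLp.coeFn_toLp f.2
  rw [← h1] at h2
  have h3 := (Measure.quasiMeasurePreserving_smul (volume : Measure ℝ) hpi).ae h2
  filter_upwards [h3] with u hu
  have e : (2 * Real.pi)⁻¹ • u = u / (2 * Real.pi) := by
    rw [smul_eq_mul, div_eq_inv_mul]
  rw [e] at hu
  rw [hat, hat, hu]
  congr 4
  field_simp

/-- The domain of `S_m` is `{f ∈ L² : ∫ m(u) |f̂(u)|² du < ∞}`. -/
theorem mem_domain_Sm {m : ℝ → ℝ} (hm : Measurable m) (hm0 : ∀ u, 0 ≤ m u) (f : L2) :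
    f ∈ (Sm m).domain ↔ Integrable fun u : ℝ => m u * ‖hat f u‖ ^ 2 := by
  have hpi : 2 * Real.pi ≠ 0 := by positivity
  change MemLp (fun v : ℝ => (√(m (2 * Real.pi * v)) : ℂ) * (𝓕 f : L2) v) 2 volume ↔ _
  have hmeas : AEStronglyMeasurable
      (fun v : ℝ => (√(m (2 * Real.pi * v)) : ℂ) * (𝓕 f : L2) v) volume := by
    refine AEStronglyMeasurable.mul (Measurable.aestronglyMeasurable ?_)
      (Lp.aestronglyMeasurable _)
    fun_prop
  rw [memLp_two_iff_integrable_sq_norm hmeas,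
    ← integrable_comp_mul_left_iff (fun u : ℝ => m u * ‖hat f u‖ ^ 2) hpi]
  refine integrable_congr (Filter.Eventually.of_forall fun v => ?_)
  simp only [hat]
  rw [norm_mul, Complex.norm_real, Real.norm_of_nonneg (Real.sqrt_nonneg _), mul_pow,
    Real.sq_sqrt (hm0 _), mul_div_cancel_left₀ v hpi]

end TernaryGrassmann

end

noncomputable section

namespace TernaryGrassmann

/-! ### The Fourier transform on `L¹ ∩ L²` -/

/-! Both processes have the form `∑ₙ (∫_0^t aₙ) eₙ` with continuous `aₙ` whose supremum grows at
most like `(n + 1)²`; the weights absorb this growth, so the series may be differentiated term by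
term.

The function `aₙ` is the inverse Fourier integral `smXi m n` of `√m ξ̂ₙ`, or its conjugate. With `û
= (u² + 1)|ξ̂ₙ|²`, the inequality `√m |ξ̂ₙ| ≤ m/(u² + 1) + û` bounds the `L¹` norm of `√m ξ̂ₙ`,
hence the supremum of `aₙ`, by a constant plus multiples of `‖ξₙ'‖²` and `‖ξₙ‖²`
(`integrable_and_integral_norm_sqrtMulFourier_le`). The ladder relations give `‖ξₙ‖ = 1` and `‖ξₙ'‖
= O(n)`.

Since the weights are monotone along the generators and `∑ c⁻²` converges, `c⁻² = O(1/n)` at the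
generators. Division by `c⁸` leaves terms of order `n² n⁻⁴`, so the series and its termwise
derivative converge in `ℓ²`, isometric to a subspace of `𝓗₋₈`, and are carried continuously into
`𝔖₋₁` (`exists_hasContinuousDeriv_integral`).

Finally `S_m` is symmetric, so `⟨ξₙ, S_m 𝟏⟩ = ⟨S_m ξₙ, 𝟏⟩` is the conjugate of `∫_0^t S_m ξₙ`. For
even `m` the function `√m ξ̂ₙ` is Hermitian, so `S_m ξₙ` is real. -/

theorem fourierInv_eq_fourier_neg_left (f : ℝ → ℂ) (w : ℝ) :
    𝓕⁻ f w = VectorFourier.fourierIntegral Real.fourierChar volume (-innerₗ ℝ) f w := by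
  rw [Real.fourierInv_eq, VectorFourier.fourierIntegral]
  simp

theorem continuous_fourier_of_integrable {f : ℝ → ℂ} (hf : Integrable f) : Continuous (𝓕 f) :=
  VectorFourier.fourierIntegral_continuous Real.continuous_fourierChar
    (L := innerₗ ℝ) continuous_inner hf

theorem continuous_fourierInv_of_integrable {f : ℝ → ℂ} (hf : Integrable f) :
    Continuous (𝓕⁻ f) := by
  have h : 𝓕⁻ f = VectorFourier.fourierIntegral Real.fourierChar volume (-innerₗ ℝ) f :=
    funext (fourierInv_eq_fourier_neg_left f)
  rw [h]
  refine VectorFourier.fourierIntegral_continuous Real.continuous_fourierChar ?_ hf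
  exact (continuous_inner (𝕜 := ℝ) (E := ℝ)).neg

theorem norm_fourier_le_integral (f : ℝ → ℂ) (w : ℝ) : ‖𝓕 f w‖ ≤ ∫ v, ‖f v‖ :=
  VectorFourier.norm_fourierIntegral_le_integral_norm Real.fourierChar volume (innerₗ ℝ) f w

theorem norm_fourierInv_le_integral (f : ℝ → ℂ) (w : ℝ) : ‖𝓕⁻ f w‖ ≤ ∫ v, ‖f v‖ := by
  rw [fourierInv_eq_fourier_neg_left]
  exact VectorFourier.norm_fourierIntegral_le_integral_norm Real.fourierChar volume _ f w

theorem integral_fourier_mul_eq {f g : ℝ → ℂ} (hf : Integrable f) (hg : Integrable g) :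
    ∫ x, 𝓕 f x * g x = ∫ x, f x * 𝓕 g x := by
  have h := VectorFourier.integral_fourierIntegral_smul_eq_flip (L := innerₗ ℝ)
    Real.continuous_fourierChar continuous_inner hf hg
  rw [flip_innerₗ] at h
  exact h

theorem integral_fourierInv_mul_eq {f g : ℝ → ℂ} (hf : Integrable f) (hg : Integrable g) :
    ∫ x, 𝓕⁻ f x * g x = ∫ x, f x * 𝓕⁻ g x := by
  have h := VectorFourier.integral_fourierIntegral_smul_eq_flip (L := -innerₗ ℝ)
    Real.continuous_fourierChar (continuous_inner (𝕜 := ℝ) (E := ℝ)).neg hf hg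
  have hflip : (-innerₗ ℝ : ℝ →ₗ[ℝ] ℝ →ₗ[ℝ] ℝ).flip = -innerₗ ℝ := by
    ext
    simp
  rw [hflip] at h
  simp only [fourierInv_eq_fourier_neg_left]
  exact h

/-- The Fourier transform on `L²` is given by the Fourier integral on `L¹ ∩ L²`. -/
theorem coeFn_fourier_toLp {f : ℝ → ℂ} (hf : Integrable f) (hf2 : MemLp f 2 volume) :
    (𝓕 hf2.toLp : L2) =ᵐ[volume] 𝓕 f := by
  -- Both sides are tested against smooth compactly supported functions: the `L²` transform is the
  -- one of tempered distributions, and the Fourier integral moves across the pairing by Fubini.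
  refine ae_eq_of_integral_contDiff_smul_eq
    ((Lp.memLp _).locallyIntegrable (by norm_num))
    (continuous_fourier_of_integrable hf).locallyIntegrable fun g hg hgc => ?_
  have hs : ContDiff ℝ (↑(⊤ : ℕ∞)) fun x => (g x : ℂ) := Complex.ofRealCLM.contDiff.comp hg
  have hc : HasCompactSupport fun x => (g x : ℂ) := hgc.comp_left Complex.ofReal_zero
  set φ := hc.toSchwartzMap hs with hφ
  have h1 := DFunLike.congr_fun (Lp.fourier_toTemperedDistribution_eq hf2.toLp) φ
  rw [TemperedDistribution.fourier_apply, Lp.toTemperedDistribution_apply,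
    Lp.toTemperedDistribution_apply] at h1
  have h2 : ∫ x, (𝓕 φ) x • (hf2.toLp : L2) x = ∫ x, 𝓕 (φ : ℝ → ℂ) x * f x := by
    refine integral_congr_ae ?_
    filter_upwards [hf2.coeFn_toLp] with x hx
    rw [hx, smul_eq_mul, SchwartzMap.fourier_coe]
  rw [h2, integral_fourier_mul_eq φ.integrable hf] at h1
  simpa [hφ] using h1.symm

/-- The inverse Fourier transform on `L²` is given by the Fourier integral on `L¹ ∩ L²`. -/
theorem coeFn_fourierInv_toLp {f : ℝ → ℂ} (hf : Integrable f) (hf2 : MemLp f 2 volume) :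
    (𝓕⁻ hf2.toLp : L2) =ᵐ[volume] 𝓕⁻ f := by
  refine ae_eq_of_integral_contDiff_smul_eq
    ((Lp.memLp _).locallyIntegrable (by norm_num))
    (continuous_fourierInv_of_integrable hf).locallyIntegrable fun g hg hgc => ?_
  have hs : ContDiff ℝ (↑(⊤ : ℕ∞)) fun x => (g x : ℂ) := Complex.ofRealCLM.contDiff.comp hg
  have hc : HasCompactSupport fun x => (g x : ℂ) := hgc.comp_left Complex.ofReal_zero
  set φ := hc.toSchwartzMap hs with hφ
  have h1 := DFunLike.congr_fun (Lp.fourierInv_toTemperedDistribution_eq hf2.toLp) φ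
  rw [TemperedDistribution.fourierInv_apply, Lp.toTemperedDistribution_apply,
    Lp.toTemperedDistribution_apply] at h1
  have h2 : ∫ x, (𝓕⁻ φ) x • (hf2.toLp : L2) x = ∫ x, 𝓕⁻ (φ : ℝ → ℂ) x * f x := by
    refine integral_congr_ae ?_
    filter_upwards [hf2.coeFn_toLp] with x hx
    rw [hx, smul_eq_mul, SchwartzMap.fourierInv_coe]
  rw [h2, integral_fourierInv_mul_eq φ.integrable hf] at h1
  simpa [hφ] using h1.symm

/-- The Fourier transform of a real function is Hermitian. -/
theorem conj_fourier_ofReal (f : ℝ → ℝ) (v : ℝ) :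
    starRingEnd ℂ (𝓕 (fun x => (f x : ℂ)) v) = 𝓕 (fun x => (f x : ℂ)) (-v) := by
  rw [Real.fourier_eq', Real.fourier_eq', ← integral_conj]
  refine integral_congr_ae (.of_forall fun x => ?_)
  simp [← Complex.exp_conj, Complex.conj_ofNat]

/-- The inverse Fourier transform of a Hermitian function is real. -/
theorem conj_fourierInv_of_hermitian {f : ℝ → ℂ} (hf : ∀ v, starRingEnd ℂ (f v) = f (-v)) (x : ℝ) :
    starRingEnd ℂ (𝓕⁻ f x) = 𝓕⁻ f x := by
  rw [Real.fourierInv_eq', ← integral_conj, ← integral_neg_eq_self]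
  refine integral_congr_ae (.of_forall fun v => ?_)
  simp [← Complex.exp_conj, hf, Complex.conj_ofNat]

/-! ### Hermite functions -/

theorem derivative_hermite_succ (n : ℕ) :
    Polynomial.derivative (Polynomial.hermite (n + 1)) =
      ((n : Polynomial ℤ) + 1) * Polynomial.hermite n := by
  induction n with
  | zero => simp
  | succ n ih =>
    rw [Polynomial.hermite_succ (n + 1), Polynomial.derivative_sub, Polynomial.derivative_mul,
      Polynomial.derivative_X, ih, Polynomial.derivative_mul, Polynomial.hermite_succ n]
    simp only [Polynomial.derivative_add, Polynomial.derivative_natCast, Polynomial.derivative_one]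
    push_cast
    ring

/-- Compares consecutive normalizing constants, so that the ladder relations for `Heₙ` pass to `ξₙ`.
-/
theorem sqrt_two_mul_mul_inv_sqrt_factorial (n : ℕ) :
    √(2 * (n + 1)) * (√((n + 1).factorial * √Real.pi))⁻¹ =
      √2 * (√(n.factorial * √Real.pi))⁻¹ := by
  have h1 : √((n + 1).factorial * √Real.pi) = √(n + 1) * √(n.factorial * √Real.pi) := by
    rw [← Real.sqrt_mul (by positivity), Nat.factorial_succ]
    push_cast
    ring_nf
  have h2 : √((n : ℝ) + 1) ≠ 0 := by positivity
  have h3 : √(n.factorial * √Real.pi) ≠ 0 := by positivity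
  rw [h1, Real.sqrt_mul (by norm_num)]
  field_simp

theorem hasDerivAt_hermiteFun_aux (n : ℕ) (x : ℝ) :
    HasDerivAt (hermiteFun n) ((√(n.factorial * √Real.pi))⁻¹ *
      (√2 * Polynomial.aeval (√2 * x) (Polynomial.derivative (Polynomial.hermite n)) -
        x * Polynomial.aeval (√2 * x) (Polynomial.hermite n)) * Real.exp (-x ^ 2 / 2)) x := by
  have h1 : HasDerivAt (fun x : ℝ => √2 * x) √2 x := by
    simpa using (hasDerivAt_id x).const_mul √2
  have h2 := ((Polynomial.hermite n).hasDerivAt_aeval (√2 * x)).comp x h1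
  have h3 : HasDerivAt (fun x : ℝ => Real.exp (-x ^ 2 / 2)) (Real.exp (-x ^ 2 / 2) * (-x)) x := by
    refine HasDerivAt.exp ?_
    refine (((hasDerivAt_id x).pow 2).neg.div_const 2).congr_deriv ?_
    simp
    ring
  refine ((h2.const_mul (√(n.factorial * √Real.pi))⁻¹).mul h3).congr_deriv ?_
  simp only [Function.comp_apply]
  ring

/-- The creation operator maps `ξₙ` to a multiple of `ξₙ₊₁`. -/
theorem hasDerivAt_hermiteFun_succ_right (n : ℕ) (x : ℝ) :
    HasDerivAt (hermiteFun n) (x * hermiteFun n x - √(2 * (n + 1)) * hermiteFun (n + 1) x) x := by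
  refine (hasDerivAt_hermiteFun_aux n x).congr_deriv ?_
  have h := sqrt_two_mul_mul_inv_sqrt_factorial n
  simp only [hermiteFun]
  rw [Polynomial.hermite_succ]
  simp only [map_sub, map_mul, Polynomial.aeval_X]
  have h2 : √(2 : ℝ) * √2 = 2 := Real.mul_self_sqrt (by norm_num)
  linear_combination ((√2 * x * Polynomial.aeval (√2 * x) (Polynomial.hermite n) -
    Polynomial.aeval (√2 * x) (Polynomial.derivative (Polynomial.hermite n))) *
      Real.exp (-x ^ 2 / 2)) * h + ((√(n.factorial * √Real.pi))⁻¹ * x *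
    Polynomial.aeval (√2 * x) (Polynomial.hermite n) * Real.exp (-x ^ 2 / 2)) * h2

/-- The annihilation operator maps `ξₙ₊₁` to a multiple of `ξₙ`. -/
theorem hasDerivAt_hermiteFun_succ_left (n : ℕ) (x : ℝ) :
    HasDerivAt (hermiteFun (n + 1))
      (√(2 * (n + 1)) * hermiteFun n x - x * hermiteFun (n + 1) x) x := by
  refine (hasDerivAt_hermiteFun_aux (n + 1) x).congr_deriv ?_
  have h := sqrt_two_mul_mul_inv_sqrt_factorial n
  have h2 : √(2 * ((n : ℝ) + 1)) * √(2 * (n + 1)) = 2 * (n + 1) :=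
    Real.mul_self_sqrt (by positivity)
  have h3 : √(2 : ℝ) * √2 = 2 := Real.mul_self_sqrt (by norm_num)
  have h4 : √2 * ((n : ℝ) + 1) * (√((n + 1).factorial * √Real.pi))⁻¹ =
      √(2 * (n + 1)) * (√(n.factorial * √Real.pi))⁻¹ := by
    linear_combination (-(1 / 2) * √2 * (√((n + 1).factorial * √Real.pi))⁻¹) * h2 +
      (1 / 2) * √2 * √(2 * (n + 1)) * h +
      (1 / 2) * √(2 * (n + 1)) * (√(n.factorial * √Real.pi))⁻¹ * h3
  rw [derivative_hermite_succ]
  simp only [hermiteFun, map_mul, map_add, map_natCast, map_one]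
  linear_combination (Polynomial.aeval (√2 * x) (Polynomial.hermite n) *
    Real.exp (-x ^ 2 / 2)) * h4

theorem continuous_hermiteFun (n : ℕ) : Continuous (hermiteFun n) :=
  continuous_iff_continuousAt.2 fun x => (hasDerivAt_hermiteFun_succ_right n x).continuousAt

theorem integrable_polynomial_mul_hermiteFun_mul (P : Polynomial ℝ) (m n : ℕ) :
    Integrable fun x => P.eval x * (hermiteFun m x * hermiteFun n x) := by
  set Q : ℕ → Polynomial ℝ := fun n => ((Polynomial.hermite n).map (Int.castRingHom ℝ)).comp
    (Polynomial.C √2 * Polynomial.X) with hQ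
  have h := (integrable_polynomial_mul_exp (P * Q m * Q n)).const_mul
    ((√(m.factorial * √Real.pi))⁻¹ * (√(n.factorial * √Real.pi))⁻¹)
  refine h.congr (Filter.Eventually.of_forall fun x => ?_)
  have e1 : ∀ n, Polynomial.aeval (√2 * x) (Polynomial.hermite n) = (Q n).eval x := fun n => by
    simp [hQ, Polynomial.aeval_def, Polynomial.eval₂_eq_eval_map]
  have e2 : Real.exp (-x ^ 2) = Real.exp (-x ^ 2 / 2) ^ 2 := by
    rw [← Real.exp_nat_mul]
    congr 1
    push_cast
    ring
  simp only [hermiteFun, e1, e2, Polynomial.eval_mul]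
  ring

theorem integrable_hermiteFun_mul (m n : ℕ) :
    Integrable fun x => hermiteFun m x * hermiteFun n x := by
  simpa using integrable_polynomial_mul_hermiteFun_mul 1 m n

theorem integrable_mul_hermiteFun_mul (m n : ℕ) :
    Integrable fun x => x * (hermiteFun m x * hermiteFun n x) := by
  simpa using integrable_polynomial_mul_hermiteFun_mul Polynomial.X m n

theorem integrable_hermiteFun (n : ℕ) : Integrable (hermiteFun n) := by
  have h1 : Integrable fun x : ℝ => (1 + x ^ 2)⁻¹ := integrable_inv_one_add_sq
  have h2 : Integrable fun x : ℝ => (1 + x ^ 2) * (hermiteFun n x * hermiteFun n x) := by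
    refine (integrable_polynomial_mul_hermiteFun_mul
      (Polynomial.C 1 + Polynomial.X ^ 2) n n).congr (.of_forall fun x => ?_)
    simp only [Polynomial.eval_add, Polynomial.eval_C, Polynomial.eval_pow, Polynomial.eval_X]
  refine (h1.add h2).mono' (continuous_hermiteFun n).aestronglyMeasurable
    (.of_forall fun x => ?_)
  simp only [Pi.add_apply]
  have h3 : 0 < 1 + x ^ 2 := by positivity
  -- AM-GM as a completed square: `2|ξₙ| ≤ (1 + x²)⁻¹ + (1 + x²) ξₙ²`.
  have h4 : (1 + x ^ 2)⁻¹ + (1 + x ^ 2) * (hermiteFun n x * hermiteFun n x) - 2 * ‖hermiteFun n x‖ =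
      (1 + x ^ 2)⁻¹ * (1 - (1 + x ^ 2) * ‖hermiteFun n x‖) ^ 2 := by
    rw [← abs_mul_abs_self (hermiteFun n x), Real.norm_eq_abs]
    field_simp
    ring
  have h5 : 0 ≤ (1 + x ^ 2)⁻¹ * (1 - (1 + x ^ 2) * ‖hermiteFun n x‖) ^ 2 := by positivity
  linarith [norm_nonneg (hermiteFun n x)]

/-- Integration by parts with the two ladder relations: the terms containing `x` cancel and `‖ξₙ₊₁‖
= ‖ξₙ‖` remains. The case `n = 0` is the Gaussian integral. -/
theorem integral_hermiteFun_mul_self (n : ℕ) : ∫ x, hermiteFun n x * hermiteFun n x = 1 := by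
  induction n with
  | zero =>
    have h : ∀ x, hermiteFun 0 x * hermiteFun 0 x = (√Real.pi)⁻¹ * Real.exp (-1 * x ^ 2) := by
      intro x
      have e : Real.exp (-1 * x ^ 2) = Real.exp (-x ^ 2 / 2) * Real.exp (-x ^ 2 / 2) := by
        rw [← Real.exp_add]
        congr 1
        ring
      have e' : (√√Real.pi)⁻¹ * (√√Real.pi)⁻¹ = (√Real.pi)⁻¹ := by
        rw [← mul_inv, Real.mul_self_sqrt (Real.sqrt_nonneg _)]
      simp only [hermiteFun, e, ← e']
      simp
      ring
    simp_rw [h]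
    rw [integral_const_mul, integral_gaussian, div_one, inv_mul_cancel₀ (by positivity)]
  | succ n ih =>
    have hs : √(2 * ((n : ℝ) + 1)) ≠ 0 := by positivity
    have i1 := (integrable_hermiteFun_mul (n + 1) (n + 1)).const_mul √(2 * ((n : ℝ) + 1))
    have i2 := integrable_mul_hermiteFun_mul n (n + 1)
    have i3 := (integrable_hermiteFun_mul n n).const_mul √(2 * ((n : ℝ) + 1))
    have h := integral_mul_deriv_eq_deriv_mul_of_integrable
      (fun x _ => hasDerivAt_hermiteFun_succ_left n x)
      (fun x _ => hasDerivAt_hermiteFun_succ_right n x)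
      ((i2.sub i1).congr (.of_forall fun x => by simp; ring))
      ((i3.sub i2).congr (.of_forall fun x => by simp; ring))
      (integrable_hermiteFun_mul (n + 1) n)
    have e1 : ∫ x, hermiteFun (n + 1) x *
        (x * hermiteFun n x - √(2 * (n + 1)) * hermiteFun (n + 1) x) =
        (∫ x, x * (hermiteFun n x * hermiteFun (n + 1) x)) -
          √(2 * (n + 1)) * ∫ x, hermiteFun (n + 1) x * hermiteFun (n + 1) x := by
      rw [← integral_const_mul, ← integral_sub i2 i1]
      congr 1 with x
      ring
    have e2 : ∫ x, (√(2 * (n + 1)) * hermiteFun n x - x * hermiteFun (n + 1) x) *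
        hermiteFun n x = √(2 * (n + 1)) * (∫ x, hermiteFun n x * hermiteFun n x) -
          ∫ x, x * (hermiteFun n x * hermiteFun (n + 1) x) := by
      rw [← integral_const_mul, ← integral_sub i3 i2]
      congr 1 with x
      ring
    rw [e1, e2, ih] at h
    refine mul_left_cancel₀ hs ?_
    linarith

theorem norm_xi (n : ℕ) : ‖xi n‖ = 1 := by
  have h : inner ℂ (xi n) (xi n) = (1 : ℂ) := by
    rw [L2.inner_def]
    have h1 : (fun x => inner ℂ (xi n x) (xi n x)) =ᵐ[volume]
        fun x => ((hermiteFun n x * hermiteFun n x : ℝ) : ℂ) := by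
      filter_upwards [(memLp_hermiteFun n).coeFn_toLp] with x hx
      change inner ℂ ((memLp_hermiteFun n).toLp _ x) ((memLp_hermiteFun n).toLp _ x) = _
      rw [hx, RCLike.inner_apply, Complex.conj_ofReal, Complex.ofReal_mul]
    rw [integral_congr_ae h1, integral_complex_ofReal, integral_hermiteFun_mul_self]
    simp
  have h2 := inner_self_eq_norm_sq (𝕜 := ℂ) (xi n)
  rw [h, RCLike.one_re] at h2
  exact (pow_eq_one_iff_of_nonneg (norm_nonneg _) two_ne_zero).1 h2.symm

/-- The derivative of the Hermite function `ξₙ`. -/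
def hermiteDeriv (n : ℕ) (x : ℝ) : ℝ :=
  -- At `n = 0` the truncated index is harmless, because its coefficient `√0` vanishes.
  √(2 * n) / 2 * hermiteFun (n - 1) x - √(2 * (n + 1)) / 2 * hermiteFun (n + 1) x

/-- The average of the two ladder relations, in which the terms `x ξₙ` cancel. -/
theorem hasDerivAt_hermiteFun (n : ℕ) (x : ℝ) :
    HasDerivAt (hermiteFun n) (hermiteDeriv n x) x := by
  have h1 := hasDerivAt_hermiteFun_succ_right n x
  have h2 : HasDerivAt (hermiteFun n) (√(2 * n) * hermiteFun (n - 1) x - x * hermiteFun n x) x := by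
    cases n with
    | zero =>
      refine (hasDerivAt_hermiteFun_aux 0 x).congr_deriv ?_
      simp [hermiteFun]
      ring
    | succ n => simpa using hasDerivAt_hermiteFun_succ_left n x
  refine h1.congr_deriv ?_
  have h3 := h1.unique h2
  rw [hermiteDeriv]
  linear_combination (1 / 2) * h3

theorem integrable_hermiteDeriv (n : ℕ) : Integrable (hermiteDeriv n) :=
  ((integrable_hermiteFun _).const_mul _).sub ((integrable_hermiteFun _).const_mul _)

theorem hermiteDeriv_ofReal (n : ℕ) : (fun x => (hermiteDeriv n x : ℂ)) =
    (√(2 * n) / 2 : ℂ) • (fun x => (hermiteFun (n - 1) x : ℂ)) -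
      (√(2 * (n + 1)) / 2 : ℂ) • fun x => (hermiteFun (n + 1) x : ℂ) := by
  ext x
  simp [hermiteDeriv]

theorem memLp_hermiteDeriv (n : ℕ) : MemLp (fun x => (hermiteDeriv n x : ℂ)) 2 volume := by
  rw [hermiteDeriv_ofReal]
  exact ((memLp_hermiteFun _).const_smul _).sub ((memLp_hermiteFun _).const_smul _)

/-- The triangle inequality with `‖ξₖ‖ = 1`. The bound is crude, but only polynomial growth in `n`
matters. -/
theorem norm_toLp_hermiteDeriv_le (n : ℕ) : ‖(memLp_hermiteDeriv n).toLp‖ ≤ 2 * (n + 1) := by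
  have h : (memLp_hermiteDeriv n).toLp =
      (√(2 * n) / 2 : ℂ) • xi (n - 1) - (√(2 * (n + 1)) / 2 : ℂ) • xi (n + 1) := by
    rw [xi, xi, ← MemLp.toLp_const_smul, ← MemLp.toLp_const_smul, ← MemLp.toLp_sub,
      MemLp.toLp_eq_toLp_iff, hermiteDeriv_ofReal]
  have h1 : √(2 * (n : ℝ)) ≤ 2 * (n + 1) :=
    Real.sqrt_le_iff.2 ⟨by positivity, by nlinarith [n.cast_nonneg (α := ℝ)]⟩
  have h2 : √(2 * ((n : ℝ) + 1)) ≤ 2 * (n + 1) :=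
    Real.sqrt_le_iff.2 ⟨by positivity, by nlinarith [n.cast_nonneg (α := ℝ)]⟩
  rw [h]
  refine (norm_sub_le _ _).trans ?_
  rw [norm_smul, norm_smul, norm_xi, norm_xi]
  simp only [norm_div, Complex.norm_real, Real.norm_of_nonneg (Real.sqrt_nonneg _),
    RCLike.norm_ofNat]
  linarith

theorem fourier_hermiteDeriv (n : ℕ) (v : ℝ) :
    𝓕 (fun x => (hermiteDeriv n x : ℂ)) v =
      (2 * Real.pi * Complex.I * v) * 𝓕 (fun x => (hermiteFun n x : ℂ)) v := by
  have hd : ∀ x, HasDerivAt (fun x => (hermiteFun n x : ℂ)) (hermiteDeriv n x) x :=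
    fun x => (hasDerivAt_hermiteFun n x).ofReal_comp
  have he : deriv (fun x => (hermiteFun n x : ℂ)) = fun x => (hermiteDeriv n x : ℂ) :=
    funext fun x => (hd x).deriv
  have h := Real.fourier_deriv (integrable_hermiteFun n).ofReal
    (fun x => (hd x).differentiableAt) (by rw [he]; exact (integrable_hermiteDeriv n).ofReal)
  rw [he] at h
  exact congrFun h v

/-- Differentiation becomes multiplication by `iu` with `u = 2πv`; the weight `u² + 1` is thus
traded for `ξₙ'`. -/
theorem one_add_sq_mul_fourier_hermiteFun (n : ℕ) (v : ℝ) :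
    ((2 * Real.pi * v) ^ 2 + 1) * ‖𝓕 (fun x => (hermiteFun n x : ℂ)) v‖ ^ 2 =
      ‖𝓕 (fun x => (hermiteDeriv n x : ℂ)) v‖ ^ 2 +
        ‖𝓕 (fun x => (hermiteFun n x : ℂ)) v‖ ^ 2 := by
  rw [fourier_hermiteDeriv]
  simp only [norm_mul, Complex.norm_real, Complex.norm_I, RCLike.norm_ofNat, mul_pow,
    Real.norm_eq_abs, sq_abs]
  ring

/-! ### Differentiable processes with values in `𝔖₋₁` -/

/-- The terms of the convergent series `∑ c⁻²` over the generators are nonincreasing, so `n + 1`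
times the `n`-th one is at most a partial sum, hence at most the total. -/
theorem Weight.exists_inv_sq_genIdx_le (c : Weight) :
    ∃ A : ℝ, ∀ n, (c (genIdx n) ^ 2)⁻¹ ≤ A / (n + 1) := by
  have hs : Summable fun n => (c (genIdx n) ^ 2)⁻¹ := by
    simpa [Function.comp_def] using (c.summable 1 le_rfl).comp_injective genIdx_injective
  have h0 : ∀ n, 0 ≤ (c (genIdx n) ^ 2)⁻¹ := fun n => by positivity
  refine ⟨∑' n, (c (genIdx n) ^ 2)⁻¹, fun n => ?_⟩
  rw [le_div_iff₀ (by positivity), mul_comm]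
  refine le_trans ?_ (hs.sum_le_tsum (Finset.range (n + 1)) fun i _ => h0 i)
  have h := Finset.card_nsmul_le_sum (Finset.range (n + 1)) (fun n => (c (genIdx n) ^ 2)⁻¹)
    (c (genIdx n) ^ 2)⁻¹ fun i hi => by
      have hin : c (genIdx i) ≤ c (genIdx n) := c.mono (Finset.mem_range_succ_iff.1 hi)
      have := c.pos (genIdx i)
      gcongr
  simpa using h

/-- The isometry `ℓ² → 𝓗_p` that divides the coefficients by `c_ν^p`. -/
def HSpace.ofEll2 (c : Weight) (p : ℤ) : lp (fun _ : Idx => ℂ) 2 →ₗᵢ[ℂ] HSpace c p where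
  toFun x := ⟨fun ν => ((c ν ^ p : ℝ) : ℂ)⁻¹ * x ν, by
    refine (memlp_iff c p _).1 ?_
    convert lp.memℓp x using 2 with ν
    exact mul_inv_cancel_left₀ (Complex.ofReal_ne_zero.2 (zpow_pos (c.pos ν) p).ne') _⟩
  map_add' x y := Subtype.ext (funext fun ν => mul_add _ (x ν) (y ν))
  map_smul' a x := Subtype.ext (funext fun ν => mul_left_comm _ a (x ν))
  norm_map' x := by
    change ‖HSpace.toEll2 c p _‖ = ‖x‖
    congr 1
    ext ν
    exact mul_inv_cancel_left₀ (Complex.ofReal_ne_zero.2 (zpow_pos (c.pos ν) p).ne') (x ν)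

theorem Dist.continuous_incl (c : Weight) (p : ℕ) : Continuous (Dist.incl c p) :=
  continuous_sInf_rng.2 fun _ ht => ht.1 p

/-- The continuous linear map `ℓ² → 𝔖₋₁` that multiplies the coefficients by `c_ν^p`. -/
def Dist.ofEll2 (c : Weight) (p : ℕ) : lp (fun _ : Idx => ℂ) 2 →L[ℝ] Dist c where
  toLinearMap :=
    (Dist.incl c p ∘ₗ (HSpace.ofEll2 c (-(p : ℤ))).toLinearMap).restrictScalars ℝ
  cont := (Dist.continuous_incl c p).comp (HSpace.ofEll2 c (-(p : ℤ))).continuous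

theorem Dist.coeff_ofEll2 (c : Weight) (p : ℕ) (x : lp (fun _ : Idx => ℂ) 2) (ν : Idx) :
    (Dist.ofEll2 c p x).coeff ν = (c ν : ℂ) ^ p * x ν := by
  change ((c ν ^ (-(p : ℤ)) : ℝ) : ℂ)⁻¹ * x ν = _
  simp

/-- The target, later `𝔖₋₁`, carries no norm, so the chain rule goes through the little-o relation
of topological vector spaces. -/
theorem hasDerivAt_continuousLinearMap_comp {E F : Type*} [NormedAddCommGroup E] [NormedSpace ℝ E]
    [AddCommGroup F] [Module ℝ F] [TopologicalSpace F] [IsTopologicalAddGroup F]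
    [ContinuousSMul ℝ F] (T : E →L[ℝ] F) {f : ℝ → E} {f' : E} {t : ℝ} (h : HasDerivAt f f' t) :
    HasDerivAt (fun s => T (f s)) (T f') t := by
  refine .of_isLittleOTVS ((T.isBigOTVS_comp.trans_isLittleOTVS
    (HasFDerivAtFilter.isLittleOTVS h.hasFDerivAt)).congr_left fun s => ?_)
  simp

theorem genSeries_genIdx (a : ℕ → ℂ) (n : ℕ) : genSeries a (genIdx n) = a n :=
  genIdx_injective.extend_apply a 0 n

/-- If the coefficients `aₙ` are continuous functions which are bounded by a fixed multiple of
`(n + 1)²`, then `t ↦ ∑ₙ (∫_0^t aₙ) eₙ` is continuously differentiable in `𝔖₋₁`. -/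
theorem exists_hasContinuousDeriv_integral (c : Weight) {a : ℕ → ℝ → ℂ}
    (ha : ∀ n, Continuous (a n)) {C : ℝ} (hC : ∀ n t, ‖a n t‖ ≤ C * (n + 1) ^ 2) :
    ∃ F : ℝ → Dist c, (∀ t, (F t).coeff = genSeries fun n => ∫ u in (0 : ℝ)..t, a n u) ∧
      HasContinuousDeriv F := by
  classical
  obtain ⟨A, hcA⟩ := c.exists_inv_sq_genIdx_le
  -- The exponent 8 gives `|wₙ| ≤ (A/(n+1))⁴`, which leaves `(n+1)⁻²` against coefficients of size
  -- `(n+1)²`; exponent 6 would leave only the divergent `1/(n+1)`.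
  set w : ℕ → ℂ := fun n => ((c (genIdx n) : ℂ) ^ 8)⁻¹ with hw
  have hw0 : ∀ n, (c (genIdx n) : ℂ) ^ 8 ≠ 0 := fun n =>
    pow_ne_zero _ (Complex.ofReal_ne_zero.2 (c.pos _).ne')
  set e : ℕ → lp (fun _ : Idx => ℂ) 2 := fun n => lp.single 2 (genIdx n) (1 : ℂ) with he
  have hwA : ∀ n, ‖w n‖ ≤ A ^ 4 / (n + 1) ^ 4 := fun n => by
    have h1 : ‖w n‖ = (c (genIdx n) ^ 2)⁻¹ ^ 4 := by
      simp only [hw, norm_inv, norm_pow, Complex.norm_real, Real.norm_of_nonneg (c.pos _).le]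
      rw [inv_pow, ← pow_mul]
    rw [h1, ← div_pow]
    exact pow_le_pow_left₀ (by positivity) (hcA n) 4
  have hterm : ∀ (n : ℕ) (z : ℂ) (B : ℝ), ‖z‖ ≤ B * (C * (n + 1) ^ 2) →
      ‖(z * w n) • e n‖ ≤ B * (C * A ^ 4 * (1 / ((n : ℝ) + 1) ^ 2)) := fun n z B hz => by
    rw [norm_smul, he, lp.norm_single (by norm_num), norm_one, mul_one, norm_mul]
    refine (mul_le_mul hz (hwA n) (norm_nonneg _) ((norm_nonneg _).trans hz)).trans_eq ?_
    field_simp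
  have hsum : Summable fun n : ℕ => C * A ^ 4 * (1 / ((n : ℝ) + 1) ^ 2) := by
    refine Summable.mul_left _ ?_
    have h := (summable_nat_add_iff 1).2 (Real.summable_one_div_nat_pow.2 one_lt_two)
    simpa using h
  have hint : ∀ n t, ‖∫ u in (0 : ℝ)..t, a n u‖ ≤ |t| * (C * (n + 1) ^ 2) := fun n t => by
    have h := intervalIntegral.norm_integral_le_of_norm_le_const
      (a := 0) (b := t) (f := a n) fun u _ => hC n u
    rw [sub_zero] at h
    linarith
  have hbd : ∀ n t, ‖(a n t * w n) • e n‖ ≤ C * A ^ 4 * (1 / ((n : ℝ) + 1) ^ 2) := fun n t => by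
    simpa using hterm n (a n t) 1 (by simpa using hC n t)
  have hsm : ∀ t, Summable fun n => ((∫ u in (0 : ℝ)..t, a n u) * w n) • e n := fun t =>
    .of_norm_bounded (hsum.mul_left |t|) fun n => hterm n _ _ (hint n t)
  refine ⟨fun t => Dist.ofEll2 c 8 (∑' n, ((∫ u in (0 : ℝ)..t, a n u) * w n) • e n),
    fun t => ?_, fun t => Dist.ofEll2 c 8 (∑' n, (a n t * w n) • e n), fun t => ?_, ?_⟩
  · ext ν
    rw [Dist.coeff_ofEll2]
    -- Evaluation at `ν` is continuous on `ℓ²`, so coefficients may be read off term by term.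
    have h1 := ((hsm t).hasSum.mapL (lp.evalCLM ℂ (fun _ : Idx => ℂ) 2 ν)).tsum_eq
    have h2 : ∀ n, lp.evalCLM ℂ (fun _ : Idx => ℂ) 2 ν
        (((∫ u in (0 : ℝ)..t, a n u) * w n) • e n) =
          ((∫ u in (0 : ℝ)..t, a n u) * w n) * (e n : Idx → ℂ) ν := fun n => rfl
    have h3 : (∑' n, ((∫ u in (0 : ℝ)..t, a n u) * w n) • e n : lp (fun _ : Idx => ℂ) 2) ν =
        ∑' n, ((∫ u in (0 : ℝ)..t, a n u) * w n) * (e n : Idx → ℂ) ν := by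
      simp_rw [h2] at h1
      exact h1.symm
    rw [h3]
    by_cases hν : ∃ k, genIdx k = ν
    · obtain ⟨k, rfl⟩ := hν
      rw [tsum_eq_single k, genSeries_genIdx]
      · have h4 : (e k : Idx → ℂ) (genIdx k) = 1 := by simp [he]
        rw [h4, mul_one, mul_left_comm, mul_inv_cancel₀ (hw0 k), mul_one]
      · intro n hn
        have h4 : (e n : Idx → ℂ) (genIdx k) = 0 := by
          simp [he, genIdx_injective.ne hn.symm]
        rw [h4, mul_zero]
    · have h4 : ∀ n, (e n : Idx → ℂ) ν = 0 := fun n => by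
        have : ν ≠ genIdx n := fun h => hν ⟨n, h.symm⟩
        simp [he, this]
      simp [h4, genSeries, Function.extend_apply' _ _ _ hν]
  -- The differentiation is done in `ℓ²`: the derivatives have a summable bound uniform in `t`, and
  -- the series converges at `0`.
  · refine hasDerivAt_continuousLinearMap_comp _
      (hasDerivAt_tsum hsum (fun n s => ?_) hbd (hsm 0) t)
    exact (((ha n).integral_hasStrictDerivAt 0 s).hasDerivAt.mul_const (w n)).smul_const (e n)
  · refine (Dist.ofEll2 c 8).continuous.comp (continuous_tsum (fun n => ?_) hsum hbd)
    exact ((ha n).mul continuous_const).smul continuous_const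

/-! ### The operator `S_m` on the indicator and the Hermite functions -/

variable {m : ℝ → ℝ}

/-- The function `√(m(2πv)) 𝓕 f(v)`, whose inverse Fourier transform is `S_m f`. -/
def sqrtMulFourier (m : ℝ → ℝ) (f : ℝ → ℂ) (v : ℝ) : ℂ := (√(m (2 * Real.pi * v)) : ℂ) * 𝓕 f v

theorem norm_sqrtMulFourier_sq (hm0 : ∀ u, 0 ≤ m u) (f : ℝ → ℂ) (v : ℝ) :
    ‖sqrtMulFourier m f v‖ ^ 2 = m (2 * Real.pi * v) * ‖𝓕 f v‖ ^ 2 := by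
  rw [sqrtMulFourier, norm_mul, Complex.norm_real, Real.norm_of_nonneg (Real.sqrt_nonneg _),
    mul_pow, Real.sq_sqrt (hm0 _)]

theorem aestronglyMeasurable_sqrtMulFourier (hm : Measurable m) {f : ℝ → ℂ} (hf : Integrable f) :
    AEStronglyMeasurable (sqrtMulFourier m f) volume := by
  refine AEStronglyMeasurable.mul (Measurable.aestronglyMeasurable ?_)
    (continuous_fourier_of_integrable hf).aestronglyMeasurable
  fun_prop

theorem integrable_comp_two_pi_mul_div (hint : Integrable fun u : ℝ => m u / (u ^ 2 + 1)) :
    Integrable fun v : ℝ => m (2 * Real.pi * v) / ((2 * Real.pi * v) ^ 2 + 1) :=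
  hint.comp_mul_left' (by positivity)

/-- The bound on `f̂` yields `m|f̂|² ≤ C m/(u² + 1)`, which is integrable. -/
theorem memLp_sqrtMulFourier (hm : Measurable m) (hm0 : ∀ u, 0 ≤ m u)
    (hint : Integrable fun u : ℝ => m u / (u ^ 2 + 1)) {f : ℝ → ℂ} (hf : Integrable f) {C : ℝ}
    (hC : ∀ v, ((2 * Real.pi * v) ^ 2 + 1) * ‖𝓕 f v‖ ^ 2 ≤ C) :
    MemLp (sqrtMulFourier m f) 2 volume := by
  have hmeas := aestronglyMeasurable_sqrtMulFourier hm hf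
  rw [memLp_two_iff_integrable_sq_norm hmeas]
  refine ((integrable_comp_two_pi_mul_div hint).const_mul C).mono' (hmeas.norm.pow 2)
    (.of_forall fun v => ?_)
  rw [norm_sqrtMulFourier_sq hm0, Real.norm_of_nonneg (mul_nonneg (hm0 _) (sq_nonneg _))]
  have h1 : 0 < (2 * Real.pi * v) ^ 2 + 1 := by positivity
  rw [mul_div_assoc', le_div_iff₀ h1]
  linarith [mul_le_mul_of_nonneg_left (hC v) (hm0 (2 * Real.pi * v))]

theorem sqrtMulFourier_ae_eq (m : ℝ → ℝ) {f : ℝ → ℂ} (hf : Integrable f)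
    (hf2 : MemLp f 2 volume) :
    (fun v : ℝ => (√(m (2 * Real.pi * v)) : ℂ) * (𝓕 hf2.toLp : L2) v) =ᵐ[volume]
      sqrtMulFourier m f := by
  filter_upwards [coeFn_fourier_toLp hf hf2] with v hv
  rw [hv, sqrtMulFourier]

theorem toLp_mem_domain_Sm (hm : Measurable m) (hm0 : ∀ u, 0 ≤ m u)
    (hint : Integrable fun u : ℝ => m u / (u ^ 2 + 1)) {f : ℝ → ℂ} (hf : Integrable f)
    (hf2 : MemLp f 2 volume) {C : ℝ} (hC : ∀ v, ((2 * Real.pi * v) ^ 2 + 1) * ‖𝓕 f v‖ ^ 2 ≤ C) :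
    hf2.toLp ∈ (Sm m).domain :=
  (memLp_sqrtMulFourier hm hm0 hint hf hC).ae_eq (sqrtMulFourier_ae_eq m hf hf2).symm

/-! ### Indicator and Hermite functions in the domain of `S_m` -/

theorem fourier_indicator_Icc {s t : ℝ} (hst : s ≤ t) (v : ℝ) :
    𝓕 ((Set.Icc s t).indicator fun _ => (1 : ℂ)) v =
      ∫ x in s..t, Complex.exp ((-2 * Real.pi * v * Complex.I) * x) := by
  rw [Real.fourier_eq', intervalIntegral.integral_of_le hst, ← integral_Icc_eq_integral_Ioc,
    ← integral_indicator measurableSet_Icc]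
  congr 1 with x
  by_cases hx : x ∈ Set.Icc s t
  · simp only [Set.indicator_of_mem hx, smul_eq_mul, mul_one]
    congr 1
    simp
    ring
  · simp [Set.indicator_of_notMem hx]

/-- Two bounds are combined: the transform is at most the length `t - s`, and `2πv` times it is a
difference of two unimodular numbers. -/
theorem one_add_sq_mul_fourier_indicator_le {s t : ℝ} (hst : s ≤ t) (v : ℝ) :
    ((2 * Real.pi * v) ^ 2 + 1) * ‖𝓕 ((Set.Icc s t).indicator fun _ => (1 : ℂ)) v‖ ^ 2 ≤
      4 + (t - s) ^ 2 := by
  rw [fourier_indicator_Icc hst]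
  have hexp : ∀ x : ℝ, ‖Complex.exp ((-2 * Real.pi * v * Complex.I) * x)‖ = 1 := fun x => by
    rw [show (-2 * Real.pi * v * Complex.I) * x = ((-2 * Real.pi * v * x : ℝ) : ℂ) * Complex.I by
      push_cast; ring, Complex.norm_exp_ofReal_mul_I]
  set J := ∫ x in s..t, Complex.exp ((-2 * Real.pi * v * Complex.I) * x) with hJ
  have h1 : ‖J‖ ≤ t - s := by
    have h := intervalIntegral.norm_integral_le_of_norm_le_const (a := s) (b := t)
      (f := fun x : ℝ => Complex.exp ((-2 * Real.pi * v * Complex.I) * x)) fun x _ => (hexp x).le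
    rwa [one_mul, abs_of_nonneg (sub_nonneg.2 hst)] at h
  have h2 : ‖(-2 * Real.pi * v * Complex.I : ℂ) * J‖ ≤ 2 := by
    rcases eq_or_ne v 0 with rfl | hv
    · simp
    · have hc : (-2 * Real.pi * v * Complex.I : ℂ) ≠ 0 := by simp [hv, Real.pi_ne_zero]
      rw [hJ, integral_exp_mul_complex hc, mul_div_cancel₀ _ hc]
      refine (norm_sub_le _ _).trans ?_
      rw [hexp, hexp]
      norm_num
  have h3 : (2 * Real.pi * v) ^ 2 * ‖J‖ ^ 2 = ‖(-2 * Real.pi * v * Complex.I : ℂ) * J‖ ^ 2 := by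
    simp only [norm_mul, Complex.norm_real, Complex.norm_I, RCLike.norm_ofNat, mul_pow,
      Real.norm_eq_abs, sq_abs, norm_neg]
    ring
  rw [add_mul, h3, one_mul]
  nlinarith [pow_le_pow_left₀ (norm_nonneg _) h2 2, pow_le_pow_left₀ (norm_nonneg _) h1 2]

theorem indicatorConstLp_Icc_mem_domain_Sm (hm : Measurable m) (hm0 : ∀ u, 0 ≤ m u)
    (hint : Integrable fun u : ℝ => m u / (u ^ 2 + 1)) {s t : ℝ} (hst : s ≤ t)
    (hfin : volume (Set.Icc s t) ≠ ⊤) :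
    (indicatorConstLp 2 measurableSet_Icc hfin 1 : L2) ∈ (Sm m).domain :=
  toLp_mem_domain_Sm hm hm0 hint
    ((integrable_indicator_iff measurableSet_Icc).2 (integrableOn_const hfin))
    (memLp_indicator_const 2 measurableSet_Icc 1 (Or.inr hfin))
    (one_add_sq_mul_fourier_indicator_le hst)

theorem ind_mem_domain_Sm (hm : Measurable m) (hm0 : ∀ u, 0 ≤ m u)
    (hint : Integrable fun u : ℝ => m u / (u ^ 2 + 1)) (t : ℝ) : ind t ∈ (Sm m).domain := by
  rw [ind]
  split_ifs with ht
  · exact indicatorConstLp_Icc_mem_domain_Sm hm hm0 hint ht _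
  · exact neg_mem (indicatorConstLp_Icc_mem_domain_Sm hm hm0 hint (not_le.1 ht).le _)

/-- The dependence of the constant on `n` is immaterial here, since it only serves membership in the
domain and in `L²`. -/
theorem one_add_sq_mul_fourier_hermiteFun_le (n : ℕ) (v : ℝ) :
    ((2 * Real.pi * v) ^ 2 + 1) * ‖𝓕 (fun x => (hermiteFun n x : ℂ)) v‖ ^ 2 ≤
      (∫ x, ‖(hermiteDeriv n x : ℂ)‖) ^ 2 + (∫ x, ‖(hermiteFun n x : ℂ)‖) ^ 2 := by
  rw [one_add_sq_mul_fourier_hermiteFun]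
  gcongr <;> exact norm_fourier_le_integral _ _

theorem xi_mem_domain_Sm (hm : Measurable m) (hm0 : ∀ u, 0 ≤ m u)
    (hint : Integrable fun u : ℝ => m u / (u ^ 2 + 1)) (n : ℕ) : xi n ∈ (Sm m).domain :=
  toLp_mem_domain_Sm hm hm0 hint (integrable_hermiteFun n).ofReal (memLp_hermiteFun n)
    (one_add_sq_mul_fourier_hermiteFun_le n)

/-! ### Quadratic growth of the `L¹` norm of `√m ξ̂ₙ` -/

/-- Plancherel's theorem on `L¹ ∩ L²`. -/
theorem integrable_and_integral_norm_fourier_sq {f : ℝ → ℂ} (hf : Integrable f)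
    (hf2 : MemLp f 2 volume) :
    Integrable (fun v => ‖𝓕 f v‖ ^ 2) ∧ ∫ v, ‖𝓕 f v‖ ^ 2 = ‖hf2.toLp‖ ^ 2 := by
  have h : (fun v => ‖(𝓕 hf2.toLp : L2) v‖ ^ 2) =ᵐ[volume] fun v => ‖𝓕 f v‖ ^ 2 := by
    filter_upwards [coeFn_fourier_toLp hf hf2] with v hv
    rw [hv]
  refine ⟨((memLp_two_iff_integrable_sq_norm (Lp.aestronglyMeasurable _)).1
    (Lp.memLp (𝓕 hf2.toLp : L2))).congr h, ?_⟩
  rw [← integral_congr_ae h, ← Lp.norm_fourier_eq hf2.toLp]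
  have h2 := inner_self_eq_norm_sq_to_K (𝕜 := ℂ) (𝓕 hf2.toLp : L2)
  rw [L2.inner_def] at h2
  simp_rw [inner_self_eq_norm_sq_to_K] at h2
  have h3 : ((∫ v, ‖(𝓕 hf2.toLp : L2) v‖ ^ 2 : ℝ) : ℂ) = ((‖(𝓕 hf2.toLp : L2)‖ ^ 2 : ℝ) : ℂ) := by
    rw [← integral_complex_ofReal]
    push_cast
    exact h2
  exact_mod_cast h3

/-- The key estimate. The integrand is the geometric mean of `m/(u² + 1)` and `(u² + 1)|ξ̂ₙ|²`,
hence at most their sum; Plancherel turns the second integral into `‖ξₙ'‖² + ‖ξₙ‖² ≤ 4(n+1)² + 1`.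
-/
theorem integrable_and_integral_norm_sqrtMulFourier_le (hm : Measurable m) (hm0 : ∀ u, 0 ≤ m u)
    (hint : Integrable fun u : ℝ => m u / (u ^ 2 + 1)) (n : ℕ) :
    Integrable (sqrtMulFourier m fun x => (hermiteFun n x : ℂ)) ∧
      ∫ v, ‖sqrtMulFourier m (fun x => (hermiteFun n x : ℂ)) v‖ ≤
        ((∫ v, m (2 * Real.pi * v) / ((2 * Real.pi * v) ^ 2 + 1)) + 5) * (n + 1) ^ 2 := by
  set M := ∫ v, m (2 * Real.pi * v) / ((2 * Real.pi * v) ^ 2 + 1) with hM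
  have hM0 : 0 ≤ M := integral_nonneg fun v => div_nonneg (hm0 _) (by positivity)
  have i1 := integrable_comp_two_pi_mul_div hint
  obtain ⟨i2, e2⟩ := integrable_and_integral_norm_fourier_sq
    (f := fun x => (hermiteDeriv n x : ℂ)) (integrable_hermiteDeriv n).ofReal (memLp_hermiteDeriv n)
  obtain ⟨i3, e3⟩ := integrable_and_integral_norm_fourier_sq
    (f := fun x => (hermiteFun n x : ℂ)) (integrable_hermiteFun n).ofReal (memLp_hermiteFun n)
  have hle : ∀ v, ‖sqrtMulFourier m (fun x => (hermiteFun n x : ℂ)) v‖ ≤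
      m (2 * Real.pi * v) / ((2 * Real.pi * v) ^ 2 + 1) +
        (‖𝓕 (fun x => (hermiteDeriv n x : ℂ)) v‖ ^ 2 +
          ‖𝓕 (fun x => (hermiteFun n x : ℂ)) v‖ ^ 2) := fun v => by
    rw [← one_add_sq_mul_fourier_hermiteFun]
    have h1 : 0 < (2 * Real.pi * v) ^ 2 + 1 := by positivity
    have h2 := norm_sqrtMulFourier_sq hm0 (fun x => (hermiteFun n x : ℂ)) v
    have h3 : 0 ≤ m (2 * Real.pi * v) / ((2 * Real.pi * v) ^ 2 + 1) := div_nonneg (hm0 _) h1.le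
    have h4 : 0 ≤ ((2 * Real.pi * v) ^ 2 + 1) * ‖𝓕 (fun x => (hermiteFun n x : ℂ)) v‖ ^ 2 := by
      positivity
    refine abs_le_of_sq_le_sq' ?_ (add_nonneg h3 h4) |>.2
    have h5 : m (2 * Real.pi * v) / ((2 * Real.pi * v) ^ 2 + 1) *
        (((2 * Real.pi * v) ^ 2 + 1) * ‖𝓕 (fun x => (hermiteFun n x : ℂ)) v‖ ^ 2) =
        ‖sqrtMulFourier m (fun x => (hermiteFun n x : ℂ)) v‖ ^ 2 := by
      rw [h2]
      field_simp
    rw [← h5]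
    nlinarith
  have hi : Integrable (sqrtMulFourier m fun x => (hermiteFun n x : ℂ)) :=
    (i1.add (i2.add i3)).mono'
      (aestronglyMeasurable_sqrtMulFourier hm (integrable_hermiteFun n).ofReal) (.of_forall hle)
  refine ⟨hi, (integral_mono hi.norm (i1.add (i2.add i3)) hle).trans ?_⟩
  have h6 : ∫ v, ‖𝓕 (fun x => (hermiteFun n x : ℂ)) v‖ ^ 2 = 1 :=
    e3.trans ((congrArg (· ^ 2) (norm_xi n)).trans (one_pow 2))
  rw [integral_add' i1 (i2.add i3), integral_add' i2 i3, h6, ← hM]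
  have h7 : ∫ v, ‖𝓕 (fun x => (hermiteDeriv n x : ℂ)) v‖ ^ 2 ≤ (2 * (n + 1)) ^ 2 :=
    e2.trans_le (pow_le_pow_left₀ (norm_nonneg _) (norm_toLp_hermiteDeriv_le n) 2)
  -- Absorbs `M + 1` into the quadratic term, whence the constant `M + 5`.
  have h8 : (1 : ℝ) ≤ (n + 1) ^ 2 := one_le_pow₀ (by linarith [n.cast_nonneg (α := ℝ)])
  nlinarith

/-- The continuous representative of `S_m ξₙ`. -/
def smXi (m : ℝ → ℝ) (n : ℕ) : ℝ → ℂ :=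
  𝓕⁻ (sqrtMulFourier m fun x => (hermiteFun n x : ℂ))

theorem Sm_xi_ae_eq (hm : Measurable m) (hm0 : ∀ u, 0 ≤ m u)
    (hint : Integrable fun u : ℝ => m u / (u ^ 2 + 1)) (n : ℕ) (h : xi n ∈ (Sm m).domain) :
    (Sm m ⟨xi n, h⟩ : L2) =ᵐ[volume] smXi m n := by
  have h2 := memLp_sqrtMulFourier hm hm0 hint (integrable_hermiteFun n).ofReal
    (one_add_sq_mul_fourier_hermiteFun_le n)
  have e : Sm m ⟨xi n, h⟩ = (𝓕⁻ h2.toLp : L2) := by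
    refine congrArg _ ((MemLp.toLp_eq_toLp_iff _ _).2 ?_)
    exact sqrtMulFourier_ae_eq m (integrable_hermiteFun n).ofReal (memLp_hermiteFun n)
  rw [e]
  exact coeFn_fourierInv_toLp (integrable_and_integral_norm_sqrtMulFourier_le hm hm0 hint n).1 h2

/-! ### Symmetry of `S_m` and reality for even `m` -/

/-- The operator `S_m` is symmetric. -/
theorem inner_Sm_right (m : ℝ → ℝ) (f g : (Sm m).domain) :
    inner ℂ (f : L2) (Sm m g) = inner ℂ (Sm m f) (g : L2) := by
  have h : ∀ k : (Sm m).domain, (𝓕 (Sm m k) : L2) = MemLp.toLp _ k.2 := fun k =>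
    (Lp.fourierTransformₗᵢ ℝ ℂ).apply_symm_apply _
  rw [← Lp.inner_fourier_eq, ← Lp.inner_fourier_eq (Sm m f), h, h, L2.inner_def, L2.inner_def]
  refine integral_congr_ae ?_
  filter_upwards [f.2.coeFn_toLp, g.2.coeFn_toLp] with v hf hg
  rw [hf, hg]
  simp only [RCLike.inner_apply, map_mul, Complex.conj_ofReal]
  ring

theorem inner_ind_left (t : ℝ) (f : L2) : inner ℂ (ind t) f = ∫ u in (0 : ℝ)..t, f u := by
  rw [ind]
  split_ifs with ht
  · rw [L2.inner_indicatorConstLp_one, intervalIntegral.integral_of_le ht,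
      integral_Icc_eq_integral_Ioc]
  · rw [inner_neg_left, L2.inner_indicatorConstLp_one,
      intervalIntegral.integral_of_ge (not_le.1 ht).le, integral_Icc_eq_integral_Ioc]

/-- Symmetry moves `S_m` onto `ξₙ`; the conjugate appears because the indicator then stands in the
second slot of the inner product. -/
theorem X_Sm_ind (m : ℝ → ℝ) (t : ℝ) (hind : ind t ∈ (Sm m).domain)
    (hxi : ∀ n, xi n ∈ (Sm m).domain) :
    X (Sm m ⟨ind t, hind⟩) =
      genSeries fun n => starRingEnd ℂ (∫ u in (0 : ℝ)..t, (Sm m ⟨xi n, hxi n⟩ : L2) u) := by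
  rw [X]
  congr 1 with n
  rw [inner_Sm_right m ⟨xi n, hxi n⟩ ⟨ind t, hind⟩, ← inner_conj_symm, inner_ind_left]

/-- As `ξₙ` is real, `ξ̂ₙ` is Hermitian, and an even real factor preserves this. -/
theorem conj_smXi (heven : ∀ u, m (-u) = m u) (n : ℕ) (x : ℝ) :
    starRingEnd ℂ (smXi m n x) = smXi m n x := by
  refine conj_fourierInv_of_hermitian (fun v => ?_) x
  rw [sqrtMulFourier, sqrtMulFourier, map_mul, conj_fourier_ofReal, Complex.conj_ofReal, mul_neg,
    heven]

theorem intervalIntegral_conj (f : ℝ → ℂ) (s t : ℝ) :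
    ∫ u in s..t, starRingEnd ℂ (f u) = starRingEnd ℂ (∫ u in s..t, f u) := by
  simp only [intervalIntegral, integral_conj, map_sub]

end TernaryGrassmann

end

/-! ### The main theorem -/

open TernaryGrassmann in
theorem mainTheorem3 (c : Weight)
    (m : ℝ → ℝ) (hm : Measurable m) (hm0 : ∀ u, 0 ≤ m u)
    (K : ℝ) (hK : 0 < K) (b : ℝ) (hb : b < 2) (N : ℕ)
    (hsmall : ∀ u : ℝ, u ≠ 0 → |u| ≤ 1 → m u ≤ K * |u| ^ (-b))
    (hlarge : ∀ u : ℝ, 1 < |u| → m u ≤ K * |u| ^ (2 * N))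
    (hint : Integrable fun u : ℝ => m u / (u ^ 2 + 1)) :
    ∃ (hind : ∀ t, ind t ∈ (Sm m).domain) (hxi : ∀ n, xi n ∈ (Sm m).domain),
      -- the process `t ↦ X S_m 𝟏_[0,t]`
      (∃ F : ℝ → Dist c, (∀ t, (F t).coeff = X (Sm m ⟨ind t, hind t⟩)) ∧
        HasContinuousDeriv F) ∧
      -- the process `t ↦ ∑ₙ (∫_0^t S_m ξₙ) eₙ`
      (∃ G : ℝ → Dist c,
        (∀ t, (G t).coeff = genSeries fun n => ∫ u in (0 : ℝ)..t, (Sm m ⟨xi n, hxi n⟩ : L2) u) ∧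
        HasContinuousDeriv G) ∧
      -- the two agree up to the complex conjugation of the coefficients, and agree for even `m`
      (∀ t, X (Sm m ⟨ind t, hind t⟩) =
        genSeries fun n => starRingEnd ℂ (∫ u in (0 : ℝ)..t, (Sm m ⟨xi n, hxi n⟩ : L2) u)) ∧
      ((∀ u, m (-u) = m u) → ∀ t, X (Sm m ⟨ind t, hind t⟩) =
        genSeries fun n => ∫ u in (0 : ℝ)..t, (Sm m ⟨xi n, hxi n⟩ : L2) u) := by
  -- The `L²` class is replaced by its continuous representative, to which the fundamental theorem
  -- of calculus applies.
  have hSm : ∀ n t (h : xi n ∈ (Sm m).domain), ∫ u in (0 : ℝ)..t, (Sm m ⟨xi n, h⟩ : L2) u =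
      ∫ u in (0 : ℝ)..t, smXi m n u := fun n t h =>
    intervalIntegral.integral_congr_ae ((Sm_xi_ae_eq hm hm0 hint n h).mono fun u hu _ => hu)
  have hcont : ∀ n, Continuous (smXi m n) := fun n =>
    continuous_fourierInv_of_integrable
      (integrable_and_integral_norm_sqrtMulFourier_le hm hm0 hint n).1
  have hbound : ∀ n t, ‖smXi m n t‖ ≤ _ := fun n t =>
    (norm_fourierInv_le_integral _ t).trans
      (integrable_and_integral_norm_sqrtMulFourier_le hm hm0 hint n).2
  refine ⟨ind_mem_domain_Sm hm hm0 hint, xi_mem_domain_Sm hm hm0 hint, ?_, ?_,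
    fun t => X_Sm_ind m t _ _, fun heven t => ?_⟩
  · obtain ⟨F, hF, hF'⟩ := exists_hasContinuousDeriv_integral c
      (a := fun n t => starRingEnd ℂ (smXi m n t))
      (fun n => Complex.continuous_conj.comp (hcont n))
      (fun n t => (RCLike.norm_conj _).trans_le (hbound n t))
    refine ⟨F, fun t => ?_, hF'⟩
    rw [hF, X_Sm_ind m t _ (xi_mem_domain_Sm hm hm0 hint)]
    simp only [hSm, intervalIntegral_conj]
  · obtain ⟨G, hG, hG'⟩ := exists_hasContinuousDeriv_integral c hcont hbound
    refine ⟨G, fun t => ?_, hG'⟩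
    rw [hG]
    simp only [hSm]
  · rw [X_Sm_ind m t _ (xi_mem_domain_Sm hm hm0 hint)]
    simp only [hSm, ← intervalIntegral_conj, conj_smXi heven]
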